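/- Let $d_1<d_2<d_3$ be positive integers with $\gcd(d_1,d_2,d_3)=1$, none of which is a nonnegative integer combination of the other two, and let $S_3=\langle d_1,d_2,d_3\rangle\subseteq\mathbb{Z}_{\ge 0}$ be the numerical semigroup which they minimally generate. Let $\Delta_3=\mathbb{Z}_{>0}\setminus S_3$ be its set of gaps, $G_0=\#\Delta_3$ its genus, $F_3=\max\Delta_3$ its Frobenius number and $c_3=F_3+1$ its conductor. Put $$\sigma_1=d_1+d_2+d_3,\quad \delta_1=\frac{\sigma_1-1}{2},\quad K_0=G_0+\delta_1,\quad g_3=F_3+\sigma_1,$$ $$h_0=\frac{K_0}{g_3},\quad w_3=\frac{G_0}{c_3},\quad e_3=\frac{\delta_1}{c_3}.$$ Then $$\frac12\le h_0<\frac59,\qquad\text{and}\qquad w_3<\frac59+\frac{e_3}{9}.$$ -/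

import Mathlib

namespace Semigroup3

/-- The additive semigroup `⟨d₁, d₂, d₃⟩ ⊆ ℕ` of all nonnegative integer combinations. -/
def semigroup (d₁ d₂ d₃ : ℕ) : AddSubmonoid ℕ :=
  AddSubmonoid.closure {d₁, d₂, d₃}

/-- The set `Δ₃` of gaps: the positive integers not in `⟨d₁, d₂, d₃⟩`. -/
def gaps (d₁ d₂ d₃ : ℕ) : Set ℕ :=
  {s | 0 < s ∧ s ∉ semigroup d₁ d₂ d₃}

/-- None of the three generators is representable by the other two. -/
def IsMinimal (d₁ d₂ d₃ : ℕ) : Prop :=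
  d₁ ∉ AddSubmonoid.closure {d₂, d₃} ∧
  d₂ ∉ AddSubmonoid.closure {d₁, d₃} ∧
  d₃ ∉ AddSubmonoid.closure {d₁, d₂}

/-- The genus `G₀`: the number of gaps. -/
noncomputable def genus (d₁ d₂ d₃ : ℕ) : ℕ :=
  (gaps d₁ d₂ d₃).ncard

/-- The Frobenius number `F₃`: the largest gap. -/
noncomputable def frobenius (d₁ d₂ d₃ : ℕ) : ℕ :=
  sSup (gaps d₁ d₂ d₃)

/-- The conductor `c₃ = F₃ + 1`. -/
noncomputable def conductor (d₁ d₂ d₃ : ℕ) : ℕ :=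
  frobenius d₁ d₂ d₃ + 1

/-- `σ₁ = d₁ + d₂ + d₃`. -/
def sigma1 (d₁ d₂ d₃ : ℕ) : ℕ :=
  d₁ + d₂ + d₃

/-- `δ₁ = (σ₁ - 1) / 2`. -/
noncomputable def delta1 (d₁ d₂ d₃ : ℕ) : ℝ :=
  ((sigma1 d₁ d₂ d₃ : ℝ) - 1) / 2

/-- `K₀ = G₀ + δ₁`. -/
noncomputable def K0 (d₁ d₂ d₃ : ℕ) : ℝ :=
  (genus d₁ d₂ d₃ : ℝ) + delta1 d₁ d₂ d₃

/-- `g₃ = F₃ + σ₁`. -/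
noncomputable def g3 (d₁ d₂ d₃ : ℕ) : ℝ :=
  (frobenius d₁ d₂ d₃ : ℝ) + (sigma1 d₁ d₂ d₃ : ℝ)

/-- The rescaled genus `h₀ = K₀ / g₃`. -/
noncomputable def h0 (d₁ d₂ d₃ : ℕ) : ℝ :=
  K0 d₁ d₂ d₃ / g3 d₁ d₂ d₃

/-- `w₃ = G₀ / c₃`. -/
noncomputable def w3 (d₁ d₂ d₃ : ℕ) : ℝ :=
  (genus d₁ d₂ d₃ : ℝ) / (conductor d₁ d₂ d₃ : ℝ)

/-- `e₃ = δ₁ / c₃`. -/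
noncomputable def e3 (d₁ d₂ d₃ : ℕ) : ℝ :=
  delta1 d₁ d₂ d₃ / (conductor d₁ d₂ d₃ : ℝ)

/-- With coprime generators there are only finitely many gaps, so `genus` counts them. -/
theorem gaps_finite {d₁ d₂ d₃ : ℕ} (hgcd : Nat.gcd d₁ (Nat.gcd d₂ d₃) = 1) :
    (gaps d₁ d₂ d₃).Finite := by
  obtain ⟨n, hn⟩ := Nat.exists_mem_closure_of_ge ({d₁, d₂, d₃} : Set ℕ)
  have h1 : Nat.setGcd ({d₁, d₂, d₃} : Set ℕ) = 1 := by
    rw [← Nat.dvd_one, ← hgcd]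
    exact Nat.dvd_gcd (Nat.setGcd_dvd_of_mem (by simp))
      (Nat.dvd_gcd (Nat.setGcd_dvd_of_mem (by simp)) (Nat.setGcd_dvd_of_mem (by simp)))
  refine (Set.finite_lt_nat n).subset fun m hm => ?_
  by_contra hlt
  exact hm.2 (hn m (not_lt.mp hlt) (by simp [h1]))

/-- For a minimal triple `1` is a gap. -/
theorem one_mem_gaps {d₁ d₂ d₃ : ℕ} (hmin : IsMinimal d₁ d₂ d₃) : 1 ∈ gaps d₁ d₂ d₃ := by
  refine ⟨one_pos, fun h => ?_⟩
  have key : ∀ s : Set ℕ, ∀ m, 1 ∈ s → m ∈ AddSubmonoid.closure s := fun s m hs => by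
    simpa using AddSubmonoid.nsmul_mem _ (AddSubmonoid.subset_closure hs) m
  have h' : (1 : ℕ) ∈ ({d₁, d₂, d₃} : Set ℕ) := Nat.one_mem_closure_iff.mp h
  obtain ⟨a, b, c⟩ := hmin
  rcases h' with h | h | h
  · exact b (key _ _ (by simp [h]))
  · exact a (key _ _ (by simp [h]))
  · exact a (key _ _ (by simp [Set.mem_singleton_iff.mp h]))

/-- For a minimal coprime triple, `frobenius` is the Frobenius number in Mathlib's sense. -/
theorem frobeniusNumber_frobenius {d₁ d₂ d₃ : ℕ} (hgcd : Nat.gcd d₁ (Nat.gcd d₂ d₃) = 1)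
    (hmin : IsMinimal d₁ d₂ d₃) :
    FrobeniusNumber (frobenius d₁ d₂ d₃) {d₁, d₂, d₃} := by
  have hb := (gaps_finite hgcd).bddAbove
  refine ⟨(Nat.sSup_mem ⟨1, one_mem_gaps hmin⟩ hb).2, fun k hk => ?_⟩
  refine le_csSup hb ⟨Nat.pos_of_ne_zero ?_, hk⟩
  rintro rfl
  exact hk (zero_mem _)

end Semigroup3

namespace Semigroup3

/-! Write x, y, n for the generators. Taking the least i x + j y in each class modulo n, with ties
broken by j, gives n standard pairs. Their values form the Apéry set and the pairs fill an L-shape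
(`exists_lShape`). Summing over the L-shape gives the genus (`two_mul_genus`), and each of its two
outer corners bounds g₃ from below.

Let D ≥ 0 be the difference of the two corner bounds. After multiplication by x y, the claim 18 n K₀
< 10 n g₃ becomes 9uvw ≤ (u+v+w)(uv+vw+uw) plus nonnegative terms in D (`corner_bound`). Equality
would need D = 0 and u = v = w, and then 3 divides all generators. The lower bound holds because s
and F₃ - s never both lie in the semigroup. -/

theorem mem_semigroup_iff {x y n s : ℕ} :
    s ∈ semigroup x y n ↔ ∃ i j k, i * x + j * y + k * n = s := by
  constructor
  · intro h
    induction h using AddSubmonoid.closure_induction with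
    | mem s hs =>
      rcases hs with rfl | rfl | hs
      · exact ⟨1, 0, 0, by simp⟩
      · exact ⟨0, 1, 0, by simp⟩
      · rw [Set.mem_singleton_iff] at hs
        exact ⟨0, 0, 1, by simp [hs]⟩
    | zero => exact ⟨0, 0, 0, by simp⟩
    | add s t _ _ hs ht =>
      obtain ⟨i, j, k, rfl⟩ := hs
      obtain ⟨i', j', k', rfl⟩ := ht
      exact ⟨i + i', j + j', k + k', by ring⟩
  · rintro ⟨i, j, k, rfl⟩
    simp only [← smul_eq_mul]
    refine add_mem (add_mem ?_ ?_) ?_ <;>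
      exact AddSubmonoid.nsmul_mem _ (AddSubmonoid.subset_closure (by simp)) _

/-- The element `i x + j y` represented by a pair of exponents. -/
def val (x y : ℕ) (p : ℕ × ℕ) : ℕ := p.1 * x + p.2 * y

theorem val_add (x y : ℕ) (p q : ℕ × ℕ) : val x y (p + q) = val x y p + val x y q := by
  simp only [val, Prod.fst_add, Prod.snd_add]
  ring

/-- A pair is standard if it is the least one in its class modulo `n`, for the order by value
and then by second exponent. -/
def IsStandard (n x y : ℕ) (p : ℕ × ℕ) : Prop :=
  ∀ q, val x y q ≡ val x y p [MOD n] →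
    val x y p < val x y q ∨ (val x y p = val x y q ∧ p.2 ≤ q.2)

/-! ### Standard pairs and their L-shape -/

section Standard

variable {n x y : ℕ}

theorem exists_isStandard (p : ℕ × ℕ) :
    ∃ q, IsStandard n x y q ∧ val x y q ≡ val x y p [MOD n] := by
  obtain ⟨q, hq, hmin⟩ := (InvImage.wf (fun p : ℕ × ℕ => toLex (val x y p, p.2))
    (wellFounded_lt (α := ℕ ×ₗ ℕ))).has_min {q | val x y q ≡ val x y p [MOD n]} ⟨p, rfl⟩
  refine ⟨q, fun r hr => ?_, hq⟩
  have := hmin r (hr.trans hq)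
  simp only [InvImage, Prod.Lex.toLex_lt_toLex] at this
  omega

theorem IsStandard.eq (hx : 0 < x) {p q : ℕ × ℕ} (hp : IsStandard n x y p)
    (hq : IsStandard n x y q) (h : val x y p ≡ val x y q [MOD n]) : p = q := by
  have h1 := hp q h.symm
  have h2 := hq p h
  have hs : p.2 = q.2 := by omega
  have hv : val x y p = val x y q := by omega
  simp only [val, hs, add_left_inj] at hv
  exact Prod.ext (Nat.eq_of_mul_eq_mul_right hx hv) hs

/-- Adding the missing part of p to a competitor of q gives a competitor of p, so standard pairs are
closed downwards. -/
theorem IsStandard.mono {p q : ℕ × ℕ} (hp : IsStandard n x y p) (h : q ≤ p) :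
    IsStandard n x y q := by
  intro r hr
  obtain ⟨s, rfl⟩ := exists_add_of_le h
  have := hp (r + s) (by rw [val_add, val_add]; exact hr.add_right _)
  rw [val_add, val_add, Prod.snd_add, Prod.snd_add] at this
  omega

theorem isStandard_zero (n x y : ℕ) : IsStandard n x y 0 := by
  intro q _
  simp only [val, Prod.fst_zero, Prod.snd_zero]
  omega

/-- Adding a common part does not change the class, so it may be cancelled. -/
theorem val_add_modEq_cancel {p q r : ℕ × ℕ}
    (h : val x y (p + r) ≡ val x y (q + r) [MOD n]) : val x y p ≡ val x y q [MOD n] := by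
  rw [val_add, val_add] at h
  exact Nat.ModEq.add_right_cancel' _ h

/-- The least nonstandard multiple on the first axis, with its standard representative. -/
theorem exists_first_axis (hn : 0 < n) (hx : 0 < x) :
    ∃ A b', (∀ i, IsStandard n x y (i, 0) ↔ i < A) ∧ IsStandard n x y (0, b') ∧
      val x y (0, b') ≡ val x y (A, 0) [MOD n] ∧ val x y (0, b') ≤ val x y (A, 0) := by
  classical
  have hex : ∃ i, ¬ IsStandard n x y (i, 0) := by
    refine ⟨n, fun h => ?_⟩
    have := h.eq hx (isStandard_zero n x y)
      ((Nat.modEq_zero_iff_dvd.2 (by simp [val])).trans (by simp [val]; rfl))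
    simp [Prod.ext_iff] at this
    omega
  have hA : ∀ i, IsStandard n x y (i, 0) ↔ i < Nat.find hex := fun i => by
    rw [Nat.lt_find_iff]
    constructor
    · intro h m hm
      exact not_not.2 (h.mono (Prod.mk_le_mk.2 ⟨hm, le_rfl⟩))
    · intro h
      exact not_not.1 (h i le_rfl)
  obtain ⟨⟨i, j⟩, hs, hc⟩ := exists_isStandard (n := n) (x := x) (y := y) (Nat.find hex, 0)
  have hle := hs _ hc.symm
  -- If i > 0, cancelling one x leaves two congruent standard pairs. They coincide, and then (A, 0)
  -- itself would be standard.
  have hi : i = 0 := by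
    by_contra hi
    obtain ⟨i, rfl⟩ := Nat.exists_eq_succ_of_ne_zero hi
    obtain ⟨A, hA'⟩ : ∃ A, Nat.find hex = A + 1 := by
      refine Nat.exists_eq_succ_of_ne_zero fun h0 => ?_
      exact absurd ((hA 0).1 (isStandard_zero n x y)) (by omega)
    rw [hA'] at hc hA
    have := (hs.mono (q := (i, j)) (Prod.mk_le_mk.2 ⟨by omega, le_rfl⟩)).eq hx
      ((hA A).2 (by omega)) (val_add_modEq_cancel (r := (1, 0)) (by simpa using hc))
    simp only [Prod.mk.injEq] at this
    obtain ⟨rfl, rfl⟩ := this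
    exact absurd ((hA (i + 1)).1 hs) (by omega)
  subst hi
  exact ⟨Nat.find hex, j, hA, hs, hc, by omega⟩

/-- The least nonstandard multiple on the second axis, with its standard representative. -/
theorem exists_second_axis (hn : 0 < n) (hx : 0 < x) :
    ∃ B a, (∀ j, IsStandard n x y (0, j) ↔ j < B) ∧ IsStandard n x y (a, 0) ∧
      val x y (a, 0) ≡ val x y (0, B) [MOD n] ∧ val x y (a, 0) ≤ val x y (0, B) := by
  classical
  have hex : ∃ j, ¬ IsStandard n x y (0, j) := by
    refine ⟨n, fun h => ?_⟩
    have := h.eq hx (isStandard_zero n x y)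
      ((Nat.modEq_zero_iff_dvd.2 (by simp [val])).trans (by simp [val]; rfl))
    simp [Prod.ext_iff] at this
    omega
  have hB : ∀ j, IsStandard n x y (0, j) ↔ j < Nat.find hex := fun j => by
    rw [Nat.lt_find_iff]
    constructor
    · intro h m hm
      exact not_not.2 (h.mono (Prod.mk_le_mk.2 ⟨le_rfl, hm⟩))
    · intro h
      exact not_not.1 (h j le_rfl)
  obtain ⟨⟨i, j⟩, hs, hc⟩ := exists_isStandard (n := n) (x := x) (y := y) (0, Nat.find hex)
  have hle := hs _ hc.symm
  have hj : j = 0 := by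
    by_contra hj
    obtain ⟨j, rfl⟩ := Nat.exists_eq_succ_of_ne_zero hj
    obtain ⟨B, hB'⟩ : ∃ B, Nat.find hex = B + 1 := by
      refine Nat.exists_eq_succ_of_ne_zero fun h0 => ?_
      exact absurd ((hB 0).1 (isStandard_zero n x y)) (by omega)
    rw [hB'] at hc hB
    have := (hs.mono (q := (i, j)) (Prod.mk_le_mk.2 ⟨le_rfl, by omega⟩)).eq hx
      ((hB B).2 (by omega)) (val_add_modEq_cancel (r := (0, 1)) (by simpa using hc))
    simp only [Prod.mk.injEq] at this
    obtain ⟨rfl, rfl⟩ := this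
    exact absurd ((hB (j + 1)).1 hs) (by omega)
  subst hj
  exact ⟨Nat.find hex, i, hB, hs, hc, by omega⟩

/-- A nonstandard pair all of whose smaller neighbours are standard, off the axes, has value
divisible by `n`. -/
theorem modEq_zero_of_minimal (hx : 0 < x) {i j : ℕ}
    (h : ¬ IsStandard n x y (i + 1, j + 1)) (hi : IsStandard n x y (i, j + 1))
    (hj : IsStandard n x y (i + 1, j)) : val x y (i + 1, j + 1) ≡ 0 [MOD n] := by
  obtain ⟨⟨k, l⟩, hs, hc⟩ := exists_isStandard (n := n) (x := x) (y := y) (i + 1, j + 1)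
  -- A representative other than 0 shares a variable with the pair. Cancelling it leaves two
  -- standard pairs, equal by uniqueness, which is absurd in each case.
  rcases Nat.eq_zero_or_pos k with rfl | hk
  · rcases Nat.eq_zero_or_pos l with rfl | hl
    · simpa [val] using hc.symm
    · obtain ⟨l, rfl⟩ := Nat.exists_eq_succ_of_ne_zero hl.ne'
      have := (hs.mono (q := (0, l)) (Prod.mk_le_mk.2 ⟨le_rfl, by omega⟩)).eq hx hj
        (val_add_modEq_cancel (r := (0, 1)) (by simpa using hc))
      simp at this
  · obtain ⟨k, rfl⟩ := Nat.exists_eq_succ_of_ne_zero hk.ne'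
    have := (hs.mono (q := (k, l)) (Prod.mk_le_mk.2 ⟨by omega, le_rfl⟩)).eq hx hi
      (val_add_modEq_cancel (r := (1, 0)) (by simpa using hc))
    simp only [Prod.mk.injEq] at this
    obtain ⟨rfl, rfl⟩ := this
    exact absurd hs h

/-- Below a nonstandard pair there is a minimal nonstandard one. -/
theorem exists_minimal_not_isStandard {p : ℕ × ℕ} (hp : ¬ IsStandard n x y p) :
    ∃ q ≤ p, ¬ IsStandard n x y q ∧ ∀ r < q, IsStandard n x y r := by
  obtain ⟨q, hq, hmin⟩ := (wellFounded_lt (α := ℕ × ℕ)).has_min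
    {q | q ≤ p ∧ ¬ IsStandard n x y q} ⟨p, le_rfl, hp⟩
  exact ⟨q, hq.1, hq.2, fun r hr => by_contra fun h => hmin r ⟨hr.le.trans hq.1, h⟩ hr⟩

/-- The standard pairs form an L-shape. -/
theorem exists_lShape (hn : 0 < n) (hx : 0 < x) :
    ∃ a a' b b' c c' : ℕ, 0 < a' ∧ 0 < b ∧
      (a + a') * x = b' * y + c * n ∧ (b + b') * y = a * x + c' * n ∧
      ∀ i j, IsStandard n x y (i, j) ↔ i < a + a' ∧ j < b + b' ∧ ¬ (a' ≤ i ∧ b ≤ j) := by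
  obtain ⟨A, b', hA, hb', hcA, hleA⟩ := exists_first_axis (y := y) hn hx
  obtain ⟨B, a, hB, ha, hcB, hleB⟩ := exists_second_axis (y := y) hn hx
  have haA := (hA a).1 ha
  have hbB := (hB b').1 hb'
  obtain ⟨a', rfl⟩ := Nat.exists_eq_add_of_lt haA
  obtain ⟨b, rfl⟩ := Nat.exists_eq_add_of_lt hbB
  obtain ⟨c, hc⟩ := (Nat.modEq_iff_dvd' hleA).1 hcA
  obtain ⟨c', hc'⟩ := (Nat.modEq_iff_dvd' hleB).1 hcB
  -- Adding the two axis relations and cancelling (a, b') shows that the inner corner is congruent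
  -- to 0.
  have hcorner : ¬ IsStandard n x y (a' + 1, b + 1) := by
    intro h
    have := h.eq hx (isStandard_zero n x y) (by
      have := hcA.add hcB
      rw [← val_add, ← val_add] at this
      refine val_add_modEq_cancel (r := (a, b')) (Nat.ModEq.trans ?_ this.symm |>.trans ?_)
      · simp only [Prod.mk_add_mk]; rw [show (a' + 1 + a, b + 1 + b') = (a + a' + 1 + 0, 0 + (b' + b + 1)) by
          ext <;> simp <;> omega]
      · simp; rfl)
    simp [Prod.ext_iff] at this
  refine ⟨a, a' + 1, b + 1, b', c, c', by omega, by omega, ?_, ?_, fun i j => ⟨fun h => ?_, ?_⟩⟩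
  · simp only [val] at hc hleA
    rw [mul_comm c, ← hc]
    simp at hleA ⊢
    rw [← add_assoc]; omega
  · simp only [val] at hc' hleB
    rw [mul_comm c', ← hc', show b + 1 + b' = b' + b + 1 by ring]
    simp at hleB ⊢
    omega
  · have h1 := (hA i).1 (h.mono (Prod.mk_le_mk.2 ⟨le_rfl, by omega⟩))
    have h2 := (hB j).1 (h.mono (Prod.mk_le_mk.2 ⟨by omega, le_rfl⟩))
    exact ⟨by omega, by omega, fun h3 => hcorner (h.mono (Prod.mk_le_mk.2 h3))⟩
  · rintro ⟨h1, h2, h3⟩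
    by_contra hns
    obtain ⟨⟨k, l⟩, hle, hkl, hmin⟩ := exists_minimal_not_isStandard hns
    obtain ⟨hki, hlj⟩ := Prod.mk_le_mk.1 hle
    rcases Nat.eq_zero_or_pos k with rfl | hk
    · exact hkl ((hB l).2 (by omega))
    rcases Nat.eq_zero_or_pos l with rfl | hl
    · exact hkl ((hA k).2 (by omega))
    obtain ⟨k, rfl⟩ := Nat.exists_eq_succ_of_ne_zero hk.ne'
    obtain ⟨l, rfl⟩ := Nat.exists_eq_succ_of_ne_zero hl.ne'
    have h0 := modEq_zero_of_minimal hx hkl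
      (hmin _ (Prod.mk_lt_mk.2 (Or.inl ⟨by omega, le_rfl⟩)))
      (hmin _ (Prod.mk_lt_mk.2 (Or.inr ⟨le_rfl, by omega⟩)))
    refine h3 ⟨?_, ?_⟩
    · by_contra hlt
      -- Adding the zero-class pair to (a, 0) and cancelling l + 1 copies of y from the second axis
      -- relation would make two distinct standard pairs, one on each axis, congruent.
      have hs : IsStandard n x y (a + (k + 1), 0) := (hA _).2 (by omega)
      have ht : IsStandard n x y (0, b' + b - l) := (hB _).2 (by omega)
      have := hs.eq hx ht (by
        refine val_add_modEq_cancel (r := (0, l + 1)) ?_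
        rw [show ((a + (k + 1), 0) + (0, l + 1) : ℕ × ℕ) = (a, 0) + (k + 1, l + 1) by simp,
          show ((0, b' + b - l) + (0, l + 1) : ℕ × ℕ) = (0, b' + b + 1) by
            simp; omega, val_add]
        exact (Nat.ModEq.add_left _ h0).trans hcB)
      simp at this
    · by_contra hlt
      have hs : IsStandard n x y (0, b' + (l + 1)) := (hB _).2 (by omega)
      have ht : IsStandard n x y (a + a' - k, 0) := (hA _).2 (by omega)
      have := hs.eq hx ht (by
        refine val_add_modEq_cancel (r := (k + 1, 0)) ?_
        rw [show ((0, b' + (l + 1)) + (k + 1, 0) : ℕ × ℕ) = (0, b') + (k + 1, l + 1) by simp,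
          show ((a + a' - k, 0) + (k + 1, 0) : ℕ × ℕ) = (a + a' + 1, 0) by
            simp; omega, val_add]
        exact (Nat.ModEq.add_left _ h0).trans hcA)
      simp at this

end Standard

/-! ### The Apéry set, the genus and the Frobenius number -/

section Apery

variable {n x y : ℕ}

theorem exists_isStandard_modEq (hgcd : Nat.gcd x (Nat.gcd y n) = 1) (hn : 0 < n) (r : ℕ) :
    ∃ p, IsStandard n x y p ∧ val x y p ≡ r [MOD n] := by
  obtain ⟨m, hm⟩ := (gaps_finite hgcd).bddAbove
  -- This element exceeds the bound m on the gaps; dropping its multiples of n keeps the class of r.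
  have hmem : r + (m + 1) * n ∈ semigroup x y n := by
    by_contra h
    have := hm (a := r + (m + 1) * n) ⟨by positivity, h⟩
    nlinarith
  obtain ⟨i, j, k, hs⟩ := mem_semigroup_iff.1 hmem
  obtain ⟨p, hp, hc⟩ := exists_isStandard (n := n) (x := x) (y := y) (i, j)
  refine ⟨p, hp, hc.trans ?_⟩
  have h1 : val x y (i, j) + k * n = r + (m + 1) * n := hs
  have h2 : val x y (i, j) + k * n ≡ r + (m + 1) * n [MOD n] := by rw [h1]
  simpa [Nat.ModEq] using h2

theorem IsStandard.mem_semigroup_iff_le {p : ℕ × ℕ} (hp : IsStandard n x y p) {s : ℕ}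
    (hs : val x y p ≡ s [MOD n]) : s ∈ semigroup x y n ↔ val x y p ≤ s := by
  rw [mem_semigroup_iff]
  constructor
  · rintro ⟨i, j, k, rfl⟩
    have := hp (i, j) (by simpa [Nat.ModEq, val] using hs.symm)
    simp only [val] at this ⊢
    omega
  · intro hle
    obtain ⟨k, hk⟩ := (Nat.modEq_iff_dvd' hle).1 hs
    refine ⟨p.1, p.2, k, ?_⟩
    rw [mul_comm k, ← hk]
    exact Nat.add_sub_cancel' hle

/-- The standard pairs represent each class modulo `n` once. -/
theorem image_val_mod (hgcd : Nat.gcd x (Nat.gcd y n) = 1) (hn : 0 < n) {L : Finset (ℕ × ℕ)}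
    (hL : ∀ p, p ∈ L ↔ IsStandard n x y p) :
    L.image (fun p => val x y p % n) = Finset.range n := by
  ext r
  simp only [Finset.mem_image, Finset.mem_range, hL]
  constructor
  · rintro ⟨p, _, rfl⟩
    exact Nat.mod_lt _ hn
  · intro hr
    obtain ⟨p, hp, hc⟩ := exists_isStandard_modEq hgcd hn r
    exact ⟨p, hp, Eq.trans hc (Nat.mod_eq_of_lt hr)⟩

theorem injOn_val_mod (hx : 0 < x) {L : Finset (ℕ × ℕ)}
    (hL : ∀ p, p ∈ L ↔ IsStandard n x y p) :
    Set.InjOn (fun p => val x y p % n) L :=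
  fun p hp q hq h => ((hL p).1 hp).eq hx ((hL q).1 hq) h

theorem card_standard (hgcd : Nat.gcd x (Nat.gcd y n) = 1) (hn : 0 < n) (hx : 0 < x)
    {L : Finset (ℕ × ℕ)} (hL : ∀ p, p ∈ L ↔ IsStandard n x y p) : L.card = n := by
  rw [← Finset.card_image_of_injOn (injOn_val_mod hx hL), image_val_mod hgcd hn hL,
    Finset.card_range]

/-- The gaps in the class of p are obtained from its Apéry element by subtracting n repeatedly. -/
theorem genus_eq_sum_div (hgcd : Nat.gcd x (Nat.gcd y n) = 1) (hn : 0 < n) (hx : 0 < x)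
    {L : Finset (ℕ × ℕ)} (hL : ∀ p, p ∈ L ↔ IsStandard n x y p) :
    genus x y n = ∑ p ∈ L, val x y p / n := by
  classical
  have key : ∀ p k, k < val x y p / n → (k + 1) * n ≤ val x y p := fun p k hk =>
    (Nat.mul_le_mul_right n hk).trans (Nat.div_mul_le_self _ _)
  have hmod : ∀ p k, k < val x y p / n → val x y p - (k + 1) * n ≡ val x y p [MOD n] :=
    fun p k hk => by
      have : val x y p - (k + 1) * n + (k + 1) * n ≡ val x y p [MOD n] := by
        rw [Nat.sub_add_cancel (key p k hk)]
      simpa [Nat.ModEq] using this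
  have hgaps : gaps x y n = ((L.sigma fun p => Finset.range (val x y p / n)).image
      fun q => val x y q.1 - (q.2 + 1) * n : Finset ℕ) := by
    ext s
    simp only [Finset.coe_image, Set.mem_image, Finset.mem_coe, Finset.mem_sigma,
      Finset.mem_range, Sigma.exists, hL]
    constructor
    · rintro ⟨_, hs⟩
      obtain ⟨p, hp, hc⟩ := exists_isStandard_modEq hgcd hn s
      rw [hp.mem_semigroup_iff_le hc, not_le] at hs
      obtain ⟨k, hk⟩ := (Nat.modEq_iff_dvd' hs.le).1 hc.symm
      obtain ⟨k, rfl⟩ : ∃ l, k = l + 1 := Nat.exists_eq_succ_of_ne_zero (by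
        rintro rfl
        simp at hk
        omega)
      rw [mul_comm] at hk
      refine ⟨p, k, ⟨hp, (Nat.le_div_iff_mul_le hn).2 ?_⟩, ?_⟩
      · rw [← Nat.succ_eq_add_one] at hk
        omega
      · omega
    · rintro ⟨p, k, ⟨hp, hk⟩, rfl⟩
      have h1 := key p k hk
      have h2 : 0 < (k + 1) * n := by positivity
      have h3 : val x y p - (k + 1) * n ∉ semigroup x y n := by
        rw [hp.mem_semigroup_iff_le (hmod p k hk).symm]
        omega
      exact ⟨Nat.pos_of_ne_zero fun h0 => h3 (h0 ▸ zero_mem _), h3⟩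
  rw [genus, hgaps, Set.ncard_coe_finset, Finset.card_image_of_injOn]
  · simp
  · rintro ⟨p, k⟩ hp ⟨q, l⟩ hq h
    simp only [Finset.coe_sigma, Set.mem_sigma_iff, Finset.mem_coe, hL, Finset.mem_range] at hp hq h
    have hpq : p = q := hp.1.eq hx hq.1
      ((hmod p k hp.2).symm.trans (h ▸ hmod q l hq.2))
    subst hpq
    have h1 := key p k hp.2
    have h2 := key p l hq.2
    have h3 : (k + 1) * n = (l + 1) * n := by omega
    have h4 := Nat.eq_of_mul_eq_mul_right hn h3
    simp only [Nat.add_right_cancel_iff] at h4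
    rw [h4]

/-- Selmer's formula for the genus. -/
theorem two_mul_genus (hgcd : Nat.gcd x (Nat.gcd y n) = 1) (hn : 0 < n) (hx : 0 < x)
    {L : Finset (ℕ × ℕ)} (hL : ∀ p, p ∈ L ↔ IsStandard n x y p) :
    2 * n * genus x y n + n * (n - 1) = 2 * ∑ p ∈ L, val x y p := by
  have h1 : ∑ p ∈ L, val x y p % n = ∑ r ∈ Finset.range n, r := by
    rw [← image_val_mod hgcd hn hL, Finset.sum_image (injOn_val_mod hx hL)]
  have h2 : ∑ p ∈ L, val x y p = n * genus x y n + ∑ r ∈ Finset.range n, r := by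
    rw [genus_eq_sum_div hgcd hn hx hL, ← h1, Finset.mul_sum, ← Finset.sum_add_distrib]
    exact Finset.sum_congr rfl fun p _ => (Nat.div_add_mod _ _).symm
  rw [h2, mul_add, ← Finset.sum_range_id_mul_two]
  ring

theorem IsStandard.val_le_frobenius_add (hgcd : Nat.gcd x (Nat.gcd y n) = 1) {p : ℕ × ℕ}
    (hn : 0 < n) (hp : IsStandard n x y p) : val x y p ≤ frobenius x y n + n := by
  rcases le_or_gt (val x y p) n with h | h
  · omega
  have hs : val x y p - n ∉ semigroup x y n := by
    rw [hp.mem_semigroup_iff_le]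
    · omega
    · have : val x y p - n + n ≡ val x y p [MOD n] := by rw [Nat.sub_add_cancel h.le]
      simpa [Nat.ModEq] using this.symm
  have := le_csSup (gaps_finite hgcd).bddAbove (a := val x y p - n) ⟨by omega, hs⟩
  simp only [frobenius]
  omega

/-- At least half of the integers in `[0, F]` are gaps. -/
theorem frobenius_lt_two_mul_genus (hgcd : Nat.gcd x (Nat.gcd y n) = 1)
    (hmin : IsMinimal x y n) : frobenius x y n + 1 ≤ 2 * genus x y n := by
  classical
  have hfin := gaps_finite hgcd
  have hF : frobenius x y n ∉ semigroup x y n := (Nat.sSup_mem ⟨1, one_mem_gaps hmin⟩ hfin.bddAbove).2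
  set F := frobenius x y n
  set T := hfin.toFinset
  have hT : genus x y n = T.card := Set.ncard_eq_toFinset_card _ hfin
  -- The reflection s ↦ F - s sends semigroup elements up to F to gaps.
  have hsub : Finset.range (F + 1) ⊆ T ∪ T.image (F - ·) := by
    intro s hs
    rw [Finset.mem_range] at hs
    by_cases h : s ∈ semigroup x y n
    · refine Finset.mem_union_right _ (Finset.mem_image.2 ⟨F - s, ?_, by omega⟩)
      have h' : F - s ∉ semigroup x y n := fun h' => hF (by
        have := add_mem h h'
        rwa [Nat.add_sub_cancel' (by omega)] at this)
      exact hfin.mem_toFinset.2 ⟨Nat.pos_of_ne_zero fun h0 => h' (h0 ▸ zero_mem _), h'⟩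
    · exact Finset.mem_union_left _ (hfin.mem_toFinset.2
        ⟨Nat.pos_of_ne_zero fun h0 => h (h0 ▸ zero_mem _), h⟩)
  have h1 := Finset.card_le_card hsub
  have h2 := Finset.card_union_le T (T.image (F - ·))
  have h3 : (T.image (F - ·)).card ≤ T.card := Finset.card_image_le
  rw [Finset.card_range] at h1
  omega

end Apery

/-! ### Sums over an L-shape -/

section LShape

/-- The L-shape with arms `A × b` and `a × B`. -/
def lShape (A a B b : ℕ) : Finset (ℕ × ℕ) :=
  Finset.range A ×ˢ Finset.range b ∪ Finset.range a ×ˢ Finset.range B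

theorem lShape_inter {A a B b : ℕ} (ha : a ≤ A) (hb : b ≤ B) :
    (Finset.range A ×ˢ Finset.range b) ∩ (Finset.range a ×ˢ Finset.range B) =
      Finset.range a ×ˢ Finset.range b := by
  ext ⟨i, j⟩
  simp only [Finset.mem_inter, Finset.mem_product, Finset.mem_range]
  omega

theorem card_lShape {A a B b : ℕ} (ha : a ≤ A) (hb : b ≤ B) :
    (lShape A a B b).card + a * b = A * b + a * B := by
  have := Finset.card_union_add_card_inter (Finset.range A ×ˢ Finset.range b)
    (Finset.range a ×ˢ Finset.range B)
  rw [lShape_inter ha hb] at this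
  simpa only [lShape, Finset.card_product, Finset.card_range] using this

theorem two_mul_sum_val_rectangle (x y A B : ℕ) :
    2 * ((∑ p ∈ Finset.range A ×ˢ Finset.range B, val x y p : ℕ) : ℝ) =
      x * B * (A * (A - 1)) + y * A * (B * (B - 1)) := by
  have h : ∀ m : ℕ, (∑ i ∈ Finset.range m, (i : ℝ)) = m * (m - 1) / 2 := fun m => by
    induction m with
    | zero => simp
    | succ m ih => rw [Finset.sum_range_succ, ih]; push_cast; ring
  simp only [val, Nat.cast_sum, Nat.cast_add, Nat.cast_mul, Finset.sum_product, Finset.sum_add_distrib,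
    ← Finset.sum_mul, Finset.sum_const, Finset.card_range, nsmul_eq_mul, ← Finset.mul_sum, h, Nat.cast_id]
  ring

theorem two_mul_sum_val_lShape (x y : ℕ) {A a B b : ℕ} (ha : a ≤ A) (hb : b ≤ B) :
    2 * ((∑ p ∈ lShape A a B b, val x y p : ℕ) : ℝ) =
      x * b * (A * (A - 1)) + y * A * (b * (b - 1)) + (x * B * (a * (a - 1)) + y * a * (B * (B - 1)))
        - (x * b * (a * (a - 1)) + y * a * (b * (b - 1))) := by
  rw [← two_mul_sum_val_rectangle, ← two_mul_sum_val_rectangle, ← two_mul_sum_val_rectangle,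
    lShape, ← lShape_inter ha hb]
  have := Finset.sum_union_inter (s₁ := Finset.range A ×ˢ Finset.range b)
    (s₂ := Finset.range a ×ˢ Finset.range B) (f := val x y)
  have h : (_ : ℝ) = _ := congrArg Nat.cast this
  rw [Nat.cast_add, Nat.cast_add] at h
  linarith

end LShape

/-! ### The upper bound -/

/-- The inequality between the symmetric polynomials that governs the genus. -/
theorem genus_polynomial_pos {u v w D : ℝ} (hu : 0 ≤ u) (hv : 0 ≤ v) (hw : 0 ≤ w) (hD : 0 ≤ D)
    (h : 0 < D ∨ (0 < v ∧ 0 < w ∧ ¬ (u = v ∧ v = w))) :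
    27 * (u * v * w) < 3 * (u + v + w) * (u * v + v * w + u * w) +
      (3 * (u + v + w) ^ 2 + 6 * (u * v + v * w + u * w)) * D + 9 * (u + v + w) * D ^ 2
        + 6 * D ^ 3 := by
  have key : 3 * (u + v + w) * (u * v + v * w + u * w) - 27 * (u * v * w) =
      3 * (u * (v - w) ^ 2 + v * (u - w) ^ 2 + w * (u - v) ^ 2) := by ring
  have h1 : 0 ≤ u * (v - w) ^ 2 := by positivity
  have h2 : 0 ≤ v * (u - w) ^ 2 := by positivity
  have h3 : 0 ≤ w * (u - v) ^ 2 := by positivity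
  have h4 : 0 ≤ (3 * (u + v + w) ^ 2 + 6 * (u * v + v * w + u * w)) * D := by positivity
  have h5 : 0 ≤ 9 * (u + v + w) * D ^ 2 := by positivity
  rcases h with h | ⟨hv', hw', hne⟩
  · have : 0 < 6 * D ^ 3 := by positivity
    linarith
  · have h6 : 0 ≤ 6 * D ^ 3 := by positivity
    -- Since u may vanish, strictness comes from a square weighted by v or w.
    by_cases huv : u = v
    · have hvw : u - w ≠ 0 := fun h0 => hne ⟨huv, by linarith⟩
      have : 0 < v * (u - w) ^ 2 := by positivity
      linarith
    · have : u - v ≠ 0 := sub_ne_zero.2 huv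
      have : 0 < w * (u - v) ^ 2 := by positivity
      linarith

/-- Nine times the rescaled genus is less than five times the larger of the two corner values. -/
theorem corner_bound {x y n a a' b b' c c' g : ℝ} (hx : 0 < x) (hy : 0 < y) (hn : 0 < n)
    (ha : 0 ≤ a) (ha' : 0 < a') (hb : 0 < b) (hb' : 0 ≤ b') (hc : 0 ≤ c) (hc' : 0 ≤ c')
    (hA : (a + a') * x = b' * y + c * n) (hB : (b + b') * y = a * x + c' * n)
    (hcard : n = (a + a') * b + a' * b')
    (hg₁ : (a + a') * x + b * y ≤ g) (hg₂ : a' * x + (b + b') * y ≤ g)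
    (hne : ¬ (a = a' ∧ b = b' ∧ a * x = b * y ∧ a * x = c * n)) :
    9 * (x * ((a + a') ^ 2 * b + a' ^ 2 * b') + y * ((a + a') * b ^ 2 + a' * ((b + b') ^ 2 - b ^ 2)))
      < 10 * n * g := by
  have hcn : c * n = a' * x + (a * x - b' * y) := by linarith
  have hcn' : c' * n = b * y - (a * x - b' * y) := by linarith
  have hxy : 0 < x * y := mul_pos hx hy
  refine lt_of_mul_lt_mul_left ?_ hxy.le
  rcases le_or_gt (b' * y) (a * x) with h | h
  -- The first corner is the larger one, by D. Here a x = u + D and b y = w + D, and `key` is three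
  -- times the inequality left after replacing g by that corner.
  · have key := genus_polynomial_pos (u := b' * y) (v := a' * x) (w := c' * n)
      (D := a * x - b' * y) (by positivity) (by positivity) (by positivity) (by linarith) (by
        rcases h.lt_or_eq with h | h
        · exact Or.inl (by linarith)
        · refine Or.inr ⟨by positivity, ?_, ?_⟩
          · rw [hcn', h, sub_self, sub_zero]
            positivity
          · rintro ⟨h1, h2⟩
            refine hne ⟨mul_right_cancel₀ hx.ne' (by linarith),
              mul_right_cancel₀ hy.ne' (by linarith), by linarith, by linarith⟩)
    rw [hcn'] at key
    have hle : x * y * (10 * n * ((a + a') * x + b * y)) ≤ x * y * (10 * n * g) := by gcongr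
    refine lt_of_lt_of_le ?_ hle
    rw [hcard]
    linarith
  · have key := genus_polynomial_pos (u := a * x) (v := c * n) (w := b * y)
      (D := b' * y - a * x) (by positivity) (by positivity) (by positivity) (by linarith)
      (Or.inl (by linarith))
    rw [hcn] at key
    have hle : x * y * (10 * n * (a' * x + (b + b') * y)) ≤ x * y * (10 * n * g) := by gcongr
    refine lt_of_lt_of_le ?_ hle
    rw [hcard]
    linarith

/-- The upper bound for the genus. -/
theorem genus_lt {x y n : ℕ} (hx : 0 < x) (hy : 0 < y) (hn : 0 < n)
    (hgcd : Nat.gcd x (Nat.gcd y n) = 1) :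
    (18 * genus x y n : ℝ) < 10 * frobenius x y n + sigma1 x y n + 9 := by
  obtain ⟨a, a', b, b', c, c', ha', hb, hA, hB, hstd⟩ := exists_lShape (y := y) hn hx
  have hL : ∀ p, p ∈ lShape (a + a') a' (b + b') b ↔ IsStandard n x y p := by
    rintro ⟨i, j⟩
    simp only [hstd, lShape, Finset.mem_union, Finset.mem_product, Finset.mem_range]
    omega
  have hcard := card_lShape (A := a + a') (a := a') (B := b + b') (b := b) (by omega) (by omega)
  have hsum := two_mul_sum_val_lShape x y (A := a + a') (a := a') (B := b + b') (b := b)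
    (by omega) (by omega)
  have hgenus := two_mul_genus hgcd hn hx hL
  rw [card_standard hgcd hn hx hL] at hcard
  have hcard' : n = (a + a') * b + a' * b' := by linarith
  have hF₁ := ((hstd (a + a' - 1) (b - 1)).2 (by omega)).val_le_frobenius_add hgcd hn
  have hF₂ := ((hstd (a' - 1) (b + b' - 1)).2 (by omega)).val_le_frobenius_add hgcd hn
  -- Adding x + y to a corner value removes both offsets by one.
  have hg₁ : (a + a') * x + b * y ≤ frobenius x y n + sigma1 x y n := by
    obtain ⟨k, hk⟩ := Nat.exists_eq_add_of_lt (show 0 < a + a' by omega)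
    obtain ⟨l, rfl⟩ := Nat.exists_eq_add_of_lt hb
    simp only [val, sigma1, hk, Nat.add_sub_cancel] at hF₁ ⊢
    linarith
  have hg₂ : a' * x + (b + b') * y ≤ frobenius x y n + sigma1 x y n := by
    obtain ⟨k, hk⟩ := Nat.exists_eq_add_of_lt (show 0 < b + b' by omega)
    obtain ⟨l, rfl⟩ := Nat.exists_eq_add_of_lt ha'
    simp only [val, sigma1, hk, Nat.add_sub_cancel] at hF₂ ⊢
    linarith
  have hne : ¬ (a = a' ∧ b = b' ∧ a * x = b * y ∧ a * x = c * n) := by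
    rintro ⟨rfl, rfl, h1, h2⟩
    have hn3 : n = 3 * (a * b) := by linarith
    have hx3 : x = 3 * (b * c) := Nat.eq_of_mul_eq_mul_left ha' (by rw [h2, hn3]; ring)
    have hy3 : y = 3 * (a * c) := Nat.eq_of_mul_eq_mul_left hb (by rw [← h1, h2, hn3]; ring)
    have : 3 ∣ Nat.gcd x (Nat.gcd y n) :=
      Nat.dvd_gcd ⟨_, hx3⟩ (Nat.dvd_gcd ⟨_, hy3⟩ ⟨_, hn3⟩)
    rw [hgcd] at this
    omega
  have hn' : (0 : ℝ) < n := by exact_mod_cast hn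
  have key := corner_bound (x := x) (y := y) (n := n) (a := a) (a' := a') (b := b) (b' := b')
    (c := c) (c' := c') (g := frobenius x y n + sigma1 x y n) (by exact_mod_cast hx)
    (by exact_mod_cast hy) hn' (by positivity) (by exact_mod_cast ha') (by exact_mod_cast hb)
    (by positivity) (by positivity) (by positivity) (by exact_mod_cast hA) (by exact_mod_cast hB)
    (by exact_mod_cast hcard') (by exact_mod_cast hg₁) (by exact_mod_cast hg₂)
    (by exact_mod_cast hne)
  have hgenus' : (2 * n * genus x y n + n * (n - 1) : ℝ) =
      2 * ((∑ p ∈ lShape (a + a') a' (b + b') b, val x y p : ℕ) : ℝ) := by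
    have := congrArg (Nat.cast (R := ℝ)) hgenus
    rw [Nat.cast_add, Nat.cast_mul n, Nat.cast_sub hn] at this
    push_cast at this ⊢
    exact this
  have hcardR : (n : ℝ) = (a + a') * b + a' * b' := by exact_mod_cast hcard'
  rw [hsum] at hgenus'
  -- The left side is 2nK₀. Writing n as the area of the L-shape, the term n(x + y) cancels the
  -- linear parts of the sum.
  have hT : (2 * n * genus x y n + n * (n - 1) + n * (x + y) : ℝ) =
      x * ((a + a') ^ 2 * b + a' ^ 2 * b') +
        y * ((a + a') * b ^ 2 + a' * ((b + b') ^ 2 - b ^ 2)) := by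
    rw [hgenus']
    nth_rw 1 [hcardR]
    push_cast
    ring
  rw [← hT] at key
  refine lt_of_mul_lt_mul_left ?_ hn'.le
  have hσ : (sigma1 x y n : ℝ) = x + y + n := by simp [sigma1]
  rw [hσ] at key ⊢
  linarith

end Semigroup3

theorem mainTheorem2 (d₁ d₂ d₃ : ℕ) (h₁₂ : d₁ < d₂) (h₂₃ : d₂ < d₃)
    (hgcd : Nat.gcd d₁ (Nat.gcd d₂ d₃) = 1)
    (hmin : Semigroup3.IsMinimal d₁ d₂ d₃) :
    (1 / 2 ≤ Semigroup3.h0 d₁ d₂ d₃ ∧ Semigroup3.h0 d₁ d₂ d₃ < 5 / 9) ∧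
    Semigroup3.w3 d₁ d₂ d₃ < 5 / 9 + Semigroup3.e3 d₁ d₂ d₃ / 9 := by
  have hd₁ : 0 < d₁ := Nat.pos_of_ne_zero fun h => hmin.1 (h ▸ zero_mem _)
  -- With denominators cleared, both upper bounds are this inequality.
  have hup := Semigroup3.genus_lt hd₁ (hd₁.trans h₁₂) (by omega) hgcd
  have hlow : (Semigroup3.frobenius d₁ d₂ d₃ + 1 : ℝ) ≤ 2 * Semigroup3.genus d₁ d₂ d₃ := by
    exact_mod_cast Semigroup3.frobenius_lt_two_mul_genus hgcd hmin
  have hσ : (0 : ℝ) < Semigroup3.sigma1 d₁ d₂ d₃ := by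
    have : 0 < Semigroup3.sigma1 d₁ d₂ d₃ := by simp only [Semigroup3.sigma1]; omega
    exact_mod_cast this
  have hg : 0 < Semigroup3.g3 d₁ d₂ d₃ := by simp only [Semigroup3.g3]; positivity
  refine ⟨⟨?_, ?_⟩, ?_⟩
  · rw [Semigroup3.h0, le_div_iff₀ hg]
    simp only [Semigroup3.g3, Semigroup3.K0, Semigroup3.delta1]
    linarith
  · rw [Semigroup3.h0, div_lt_iff₀ hg]
    simp only [Semigroup3.g3, Semigroup3.K0, Semigroup3.delta1]
    linarith
  · have hc : (0 : ℝ) < Semigroup3.conductor d₁ d₂ d₃ := by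
      simp only [Semigroup3.conductor]; positivity
    have hc' : (Semigroup3.conductor d₁ d₂ d₃ : ℝ) = Semigroup3.frobenius d₁ d₂ d₃ + 1 := by
      simp [Semigroup3.conductor]
    rw [Semigroup3.w3, Semigroup3.e3, div_lt_iff₀ hc, add_mul, div_div, mul_comm _ (9 : ℝ),
      ← div_div, div_mul_cancel₀ _ hc.ne', hc', Semigroup3.delta1]
    linarith
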